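/- Let $n\ge 3$ and $2\le k\le n-1$, and let $\mathcal I$ be the set of all $k$-element subsets of $\{1,\dots,n\}$. For $I\in\mathcal I$ let $\mathbb Z^k_I=\{\sum_{i\in I}x_ie_i: x_i\in\mathbb Z\}\subset\mathbb Z^n$ and let $\pi_I:\mathbb Z^n\to\mathbb Z^k_I$ be the orthogonal projection. Given $\mathbf p=(p_I)_{I\in\mathcal I}\in[0,1]^{\mathcal I}$, let $\omega_I(u)$, for $I\in\mathcal I$ and $u\in\mathbb Z^k_I$, be independent Bernoulli random variables with values in $\{0,1\}$ and means $p_I$, and let $\mathbb P_{\mathbf p}$ be the law on $\{0,1\}^{\mathbb Z^n}$ of the configuration $\omega$ given by $\omega(v)=\prod_{I\in\mathcal I}\omega_I(\pi_I(v))$ for $v\in\mathbb Z^n$. A site $v$ is open if $\omega(v)=1$. Let $[o\leftrightarrow\partial B(K)]$ be the event that the origin $o$ is connected to some site at $\ell_\infty$-distance $K$ from $o$ by a nearest-neighbour path in $\mathbb Z^n$ all of whose sites (endpoints included) are open, and let $[o\nleftrightarrow\infty]$ be the event that $o$ does not belong to an infinite connected component of open sites. Then there is $\varepsilon=\varepsilon(n,k)>0$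 such that for every $\mathbf p\in[0,1]^{\mathcal I}$ with $1-\varepsilon<p_I<1$ for all $I\in\mathcal I$, there exist constants $c=c(\mathbf p)>0$ and $\alpha=\alpha(\mathbf p)>0$ such that $$\mathbb P_{\mathbf p}\big(o\leftrightarrow\partial B(K),\ o\nleftrightarrow\infty\big)\ \ge\ c\,K^{-\alpha}\qquad\text{for every integer } K>0.$$ -/

import Mathlib

open MeasureTheory ProbabilityTheory

namespace HyperplanePercolation

/-- The sites of the lattice `ℤⁿ`; the coordinates are indexed by `Fin n`. -/
abbrev Site (n : ℕ) : Type := Fin n → ℤ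

/-- The family of `k`-element subsets of the set of coordinates. -/
abbrev IndexSet (k n : ℕ) : Type := {I : Finset (Fin n) // I.card = k}

/-- The coordinate hyperplane `ℤᵏ_I`: the integer combinations of the `e_i` with `i ∈ I`, that is,
the sites of `ℤⁿ` whose coordinates outside `I` vanish. -/
abbrev CoordHyperplane {k n : ℕ} (I : IndexSet k n) : Type :=
  {x : Site n // ∀ i, i ∉ I.1 → x i = 0}

/-- The orthogonal projection of `ℤⁿ` onto `ℤᵏ_I`. -/
def proj {k n : ℕ} (I : IndexSet k n) (v : Site n) : CoordHyperplane I :=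
  ⟨fun i => if i ∈ I.1 then v i else 0, fun _ hi => if_neg hi⟩

/-- Site configurations on `G`; `true` stands for `1` (open) and `false` for `0` (closed). -/
abbrev Config (G : Type) : Type := G → Bool

/-- Bernoulli site percolation on `G` with parameter `p`: the states of the sites are
independent, and each of them is open with probability `p`. -/
noncomputable def bernoulliSite (G : Type) (p : unitInterval) : Measure (Config G) :=
  Measure.infinitePi fun _ : G => bernoulliMeasure true false p

instance (G : Type) (p : unitInterval) : IsProbabilityMeasure (bernoulliSite G p) := by
  unfold bernoulliSite
  infer_instance

/-- The configuration on `ℤⁿ` given by `ω(v) = ∏_I ω_I(π_I(v))`: the site `v` is open if and only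
if each of its projections `π_I(v)` is open in `ω_I`. -/
def hyperplaneConfig {k n : ℕ} (ω : ∀ I : IndexSet k n, Config (CoordHyperplane I)) :
    Config (Site n) :=
  fun v => decide (∀ I : IndexSet k n, ω I (proj I v) = true)

theorem measurable_hyperplaneConfig {k n : ℕ} :
    Measurable (hyperplaneConfig (k := k) (n := n)) := by
  refine measurable_pi_iff.2 fun v => measurable_to_bool ?_
  have h : (fun ω : ∀ I : IndexSet k n, Config (CoordHyperplane I) =>
      hyperplaneConfig ω v) ⁻¹' {true} = ⋂ I : IndexSet k n, {ω | ω I (proj I v) = true} := by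
    ext ω
    simp [hyperplaneConfig]
  rw [h]
  refine MeasurableSet.iInter fun I => ?_
  have hm : Measurable fun ω : ∀ I : IndexSet k n, Config (CoordHyperplane I) =>
      ω I (proj I v) := (measurable_pi_apply _).comp (measurable_pi_apply I)
  exact hm (measurableSet_singleton true)

/-- The law of Bernoulli `(n,k)`-hyperplane percolation with parameters `p = (p_I)`: the image under
`hyperplaneConfig` of the product of the laws of the percolations `ω_I` on the `ℤᵏ_I`. -/
noncomputable def percolationLaw {k n : ℕ} (p : IndexSet k n → unitInterval) :
    Measure (Config (Site n)) :=
  (Measure.pi fun I : IndexSet k n => bernoulliSite (CoordHyperplane I) (p I)).map hyperplaneConfig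

instance {k n : ℕ} (p : IndexSet k n → unitInterval) :
    IsProbabilityMeasure (percolationLaw p) :=
  Measure.isProbabilityMeasure_map measurable_hyperplaneConfig.aemeasurable

/-- The `ℤⁿ` lattice: two sites are adjacent when their `ℓ¹`-distance is one. -/
def lattice (n : ℕ) : SimpleGraph (Site n) where
  Adj x y := ∑ i, |x i - y i| = 1
  symm := ⟨fun x y h => by simpa only [abs_sub_comm] using h⟩
  loopless := ⟨fun x h => by simp at h⟩

/-- `x ↔ y` in `η`: some path of `η`-open sites starts at `x` and ends at `y`. -/
def Connected {n : ℕ} (η : Config (Site n)) (x y : Site n) : Prop :=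
  ∃ γ : (lattice n).Walk x y, γ.IsPath ∧ ∀ z ∈ γ.support, η z = true

/-- The cluster of `x` in `η`, which is empty when `x` is closed. -/
def cluster {n : ℕ} (η : Config (Site n)) (x : Site n) : Set (Site n) :=
  {y | Connected η x y}

/-- The sites at `ℓ^∞`-distance exactly `K` from the origin. -/
def boxBoundary (n K : ℕ) : Set (Site n) :=
  {x | (∀ i, |x i| ≤ (K : ℤ)) ∧ ∃ i, |x i| = (K : ℤ)}

/-- The event that the origin is connected to a site of `∂B(K)`. -/
def connectedToBoundary (n K : ℕ) : Set (Config (Site n)) :=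
  {η | ∃ y ∈ boxBoundary n K, Connected η 0 y}

/-- The event that the origin belongs to an infinite cluster. -/
def connectedToInfinity (n : ℕ) : Set (Config (Site n)) :=
  {η | (cluster η 0).Infinite}

end HyperplanePercolation

/-! Write `n = d + 1`, single out the last coordinate as height, and take a staircase in `ℤᵈ` with
`M + 1` vertices, where `M + 1 = d * r` is of order `log K`. Over it stands a vertical strip of
heights `0` to `K`.

The barrier prescribes `O(M)` hyperplane states. It opens all projections of the bottom of the strip
and closes enough places around it to confine the origin's cluster to a finite region
(`not_connectedToInfinity`). By independence its probability is at least `q ^ O(log K)`, a power of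
`K`. What remains is that, given the barrier, the origin reaches height `K` with probability at
least `1/2`.

If it does not, planar duality (`exists_star_crossing`) gives a closed `*`-path across the strip.
Projections along `I` without the vertical direction ignore height, so the barrier keeps them open;
each closed point is therefore caused by some `I` containing the vertical direction. Labelling
points by such `I`, there are at most `(K + 1) * (9N) ^ (M + 1)` labelled paths, `N` being the
number of index sets. Different points may share a projected place, but as `k ≥ 2` the set `I` also
contains a horizontal direction, and at most `d` points share one
(`length_le_mul_card_image_labelProj`). So a path forces `r` independent closures, none at a place
of the barrier. With `ε = (18N) ^ (-d)` the union bound is at most `(K + 1) * 2 ^ (-r) ≤ 1/2`. -/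

namespace HyperplanePercolation

/-! ### Duality for crossings of a planar strip -/

/-- Two points of the quadrant `ℕ²` are near if their `ℓ^∞`-distance is at most one. -/
def Near (x y : ℕ × ℕ) : Prop :=
  x.1 ≤ y.1 + 1 ∧ y.1 ≤ x.1 + 1 ∧ x.2 ≤ y.2 + 1 ∧ y.2 ≤ x.2 + 1

/-- The `*`-adjacency graph induced on the set of closed points. -/
def starGraph (C : ℕ × ℕ → Prop) : SimpleGraph (ℕ × ℕ) where
  Adj x y := x ≠ y ∧ C x ∧ C y ∧ Near x y
  symm := ⟨fun x y h => ⟨h.1.symm, h.2.2.1, h.2.1, by unfold Near at *; omega⟩⟩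
  loopless := ⟨fun x h => h.1 rfl⟩

/-- The number of edges of a unit square joining `R` to `X` is even. If no corner is in `X` there
are none; otherwise every corner outside `R` next to one in `R` is in `X`, so these edges are
exactly the changes of `R` around a 4-cycle. -/
theorem xor_square {ra rb re rf xa xb xe xf : Prop}
    (na : xa → ¬ra) (nb : xb → ¬rb) (ne : xe → ¬re) (nf : xf → ¬rf)
    (ab : ra → ¬rb → (xa ∨ xe ∨ xf) → xb) (ba : rb → ¬ra → (xb ∨ xe ∨ xf) → xa)
    (ae : ra → ¬re → (xa ∨ xb ∨ xf) → xe) (ea : re → ¬ra → (xb ∨ xe ∨ xf) → xa)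
    (bf : rb → ¬rf → (xa ∨ xb ∨ xe) → xf) (fb : rf → ¬rb → (xa ∨ xe ∨ xf) → xb)
    (ef : re → ¬rf → (xa ∨ xb ∨ xe) → xf) (fe : rf → ¬re → (xa ∨ xb ∨ xf) → xe)
    {p q : Prop} (h : Xor p q ↔ (ra ∧ xb) ∨ (xa ∧ rb)) :
    Xor (Xor p ((ra ∧ xe) ∨ (xa ∧ re))) (Xor q ((rb ∧ xf) ∨ (xb ∧ rf))) ↔
      (re ∧ xf) ∨ (xe ∧ rf) := by
  by_cases ra <;> by_cases rb <;> by_cases re <;> by_cases rf <;> simp_all [Xor] <;> grind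

/-- A parity argument replaces planar topology: the parity of the number of edges joining `R` to the
`*`-cluster of the left side is the same along every column. It is odd on the left, hence odd on the
right, so the cluster gets there. -/
theorem exists_star_crossing (M K : ℕ) (R C : ℕ × ℕ → Prop)
    (h0 : ∀ j ≤ M, R (j, 0)) (hK : ∀ j ≤ M, ¬R (j, K)) (hRC : ∀ x, C x → ¬R x)
    (hh : ∀ j < M, ∀ h ≤ K, (R (j, h) → ¬R (j + 1, h) → C (j + 1, h)) ∧
      (R (j + 1, h) → ¬R (j, h) → C (j, h)))
    (hv : ∀ j ≤ M, ∀ h < K, (R (j, h) → ¬R (j, h + 1) → C (j, h + 1)) ∧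
      (R (j, h + 1) → ¬R (j, h) → C (j, h))) :
    ∃ h h', C (0, h) ∧ (starGraph C).Reachable (0, h) (M, h') := by
  obtain ⟨X, hX⟩ : ∃ X : ℕ × ℕ → Prop, ∀ x,
      X x ↔ C x ∧ ∃ h, C (0, h) ∧ (starGraph C).Reachable (0, h) x := ⟨_, fun _ => Iff.rfl⟩
  have X0 : ∀ h, C (0, h) → X (0, h) := fun h hc => (hX _).2 ⟨hc, h, hc, .rfl⟩
  have XR : ∀ x, X x → ¬R x := fun x hx => hRC x ((hX x).1 hx).1
  have Xn : ∀ x y, Near x y → C y → X x → X y := by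
    intro x y hxy hy hx'
    obtain ⟨hx, h, hc, hr⟩ := (hX x).1 hx'
    by_cases e : x = y
    · exact e ▸ hx'
    · refine (hX y).2 ⟨hy, h, hc, hr.trans (SimpleGraph.Adj.reachable ?_)⟩
      exact ⟨e, hx, hy, hxy⟩
  let c : ℕ × ℕ → ℕ × ℕ → Prop := fun a b => (R a ∧ X b) ∨ (X a ∧ R b)
  -- `N j h` is the parity of the number of `R`–`X` edges in column `j` up to height `h`.
  obtain ⟨N, N0, NS⟩ : ∃ N : ℕ → ℕ → Prop, (∀ j, N j 0 = False) ∧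
      ∀ j h, N j (h + 1) = Xor (N j h) (c (j, h) (j, h + 1)) :=
    ⟨fun j h => Nat.rec False (fun i q => Xor q (c (j, i) (j, i + 1))) h,
      fun _ => rfl, fun _ _ => rfl⟩
  -- In column `0` every closed point is in `X`, so each change of `R` is counted.
  have claim1 : ∀ h ≤ K, (N 0 h ↔ ¬R (0, h)) := by
    intro h
    induction h with
    | zero => intro _; simp [N0, h0 0 (Nat.zero_le _)]
    | succ h ih =>
      intro hle
      have ih := ih (by omega)
      have h1 := hv 0 (Nat.zero_le _) h (by omega)
      have h2 := X0 h
      have h3 := X0 (h + 1)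
      have h4 := XR (0, h)
      have h5 := XR (0, h + 1)
      rw [NS, ih]
      simp only [c, Xor]
      grind
  have claim2 : ∀ j < M, ∀ h ≤ K, (Xor (N j h) (N (j + 1) h) ↔ c (j, h) (j + 1, h)) := by
    intro j hj h
    induction h with
    | zero =>
      intro _
      have h1 := h0 j hj.le
      have h2 := h0 (j + 1) hj
      have h3 := XR (j, 0)
      have h4 := XR (j + 1, 0)
      simp only [c, N0, Xor]
      grind
    | succ h ih =>
      intro hle
      have ih := ih (by omega)
      obtain ⟨ab, ba⟩ := hh j hj h (by omega)
      obtain ⟨ef, fe⟩ := hh j hj (h + 1) hle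
      obtain ⟨ae, ea⟩ := hv j hj.le h (by omega)
      obtain ⟨bf, fb⟩ := hv (j + 1) hj h (by omega)
      rw [NS, NS]
      apply xor_square (XR _) (XR _) (XR _) (XR _) ?_ ?_ ?_ ?_ ?_ ?_ ?_ ?_ ih
      all_goals
        intro h1 h2 h3
        rcases h3 with h3 | h3 | h3 <;>
        · refine Xn _ _ ?_ (by
            first | exact ab h1 h2 | exact ba h1 h2 | exact ef h1 h2 | exact fe h1 h2 | exact ae h1 h2 | exact ea h1 h2 | exact bf h1 h2 | exact fb h1 h2) h3
          exact ⟨by dsimp only; omega, by dsimp only; omega, by dsimp only; omega,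
            by dsimp only; omega⟩
  -- The top row misses `R`, so its horizontal edges do not alter the parity.
  have claim3 : ∀ j ≤ M, N j K := by
    intro j
    induction j with
    | zero => intro _; exact (claim1 K le_rfl).2 (hK 0 (Nat.zero_le _))
    | succ j ih =>
      intro hj
      have h1 := claim2 j hj K le_rfl
      have h2 := ih (by omega)
      have h3 := hK j (by omega)
      have h4 := hK (j + 1) hj
      simp only [c, Xor] at h1
      grind
  have claim4 : ∀ h, N M h → ∃ h', X (M, h') := by
    intro h
    induction h with
    | zero => intro h; simp [N0] at h
    | succ h ih =>
      intro hN
      rw [NS] at hN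
      by_cases hq : N M h
      · exact ih hq
      · have : c (M, h) (M, h + 1) := by simpa [Xor, hq] using hN
        rcases this with h | h
        · exact ⟨_, h.2⟩
        · exact ⟨_, h.1⟩
  obtain ⟨h', hX'⟩ := claim4 K (claim3 M le_rfl)
  obtain ⟨-, h, hc, hr⟩ := (hX _).1 hX'
  exact ⟨h, h', hc, hr⟩

/-! ### Counting labelled `*`-paths -/

/-- The points near `x`. -/
def nbhd (x : ℕ × ℕ) : Finset (ℕ × ℕ) :=
  Finset.Icc (x.1 - 1) (x.1 + 1) ×ˢ Finset.Icc (x.2 - 1) (x.2 + 1)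

theorem mem_nbhd {x y : ℕ × ℕ} (h : Near x y) : y ∈ nbhd x := by
  unfold Near at h
  simp only [nbhd, Finset.mem_product, Finset.mem_Icc]
  omega

theorem card_nbhd_le (x : ℕ × ℕ) : (nbhd x).card ≤ 9 := by
  simp only [nbhd, Finset.card_product, Nat.card_Icc]
  calc _ ≤ 3 * 3 := Nat.mul_le_mul (by omega) (by omega)
    _ = 9 := rfl

open Classical in
/-- The `*`-paths with `m + 1` points that start at `x`, each point carrying a label. -/
noncomputable def labelledPaths (β : Type) [Fintype β] :
    ℕ → ℕ × ℕ → Finset (List ((ℕ × ℕ) × β))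
  | 0, x => Finset.univ.image fun i => [(x, i)]
  | m + 1, x => Finset.univ.biUnion fun i => (nbhd x).biUnion fun y =>
      (labelledPaths β m y).image (List.cons (x, i))

theorem card_labelledPaths_le (β : Type) [Fintype β] (m : ℕ) (x : ℕ × ℕ) :
    (labelledPaths β m x).card ≤ (9 * Fintype.card β) ^ (m + 1) := by
  classical
  induction m generalizing x with
  | zero =>
    rw [labelledPaths]
    refine Finset.card_image_le.trans ?_
    rw [Finset.card_univ]
    simp only [zero_add, pow_one]
    omega
  | succ m ih =>
    rw [labelledPaths]
    refine (Finset.card_biUnion_le_card_mul _ _ (9 * (9 * Fintype.card β) ^ (m + 1)) ?_).trans ?_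
    · intro i _
      refine (Finset.card_biUnion_le_card_mul _ _ _
        fun y _ => Finset.card_image_le.trans (ih y)).trans ?_
      exact Nat.mul_le_mul_right _ (card_nbhd_le x)
    · rw [Finset.card_univ, pow_succ _ (m + 1)]
      apply le_of_eq
      ring

theorem map_take_support_mem_labelledPaths {β : Type} [Fintype β] {C : ℕ × ℕ → Prop}
    (l : ℕ × ℕ → β) (m : ℕ) {x y : ℕ × ℕ} (w : (starGraph C).Walk x y) (hw : m ≤ w.length) :
    ((w.support.take (m + 1)).map fun t => (t, l t)) ∈ labelledPaths β m x := by
  classical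
  induction m generalizing x with
  | zero =>
    rw [labelledPaths]
    cases w <;> simp
  | succ m ih =>
    rw [labelledPaths]
    cases w with
    | nil => simp at hw
    | cons h q =>
      rw [SimpleGraph.Walk.support_cons, List.take_succ_cons, List.map_cons]
      simp only [Finset.mem_biUnion, Finset.mem_univ, true_and, Finset.mem_image]
      refine ⟨l x, _, mem_nbhd h.2.2.2, _, ih q ?_, rfl⟩
      simpa using hw

theorem le_add_length_starGraph {C : ℕ × ℕ → Prop} {x y : ℕ × ℕ} (w : (starGraph C).Walk x y) :
    y.1 ≤ x.1 + w.length := by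
  induction w with
  | nil => simp
  | cons h q ih =>
    have := h.2.2.2.2.1
    rw [SimpleGraph.Walk.length_cons]
    omega

theorem mem_support_starGraph {C : ℕ × ℕ → Prop} {x y : ℕ × ℕ} (w : (starGraph C).Walk x y)
    (hx : C x) : ∀ t ∈ w.support, C t := by
  induction w with
  | nil => simpa using hx
  | cons h q ih =>
    intro t ht
    rw [SimpleGraph.Walk.support_cons, List.mem_cons] at ht
    rcases ht with rfl | ht
    · exact hx
    · exact ih h.2.2.1 t ht

/-- A `*`-step changes the column by at most one, so a self-avoiding crossing has at least `M + 1`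
vertices; the first `M + 1` are kept. -/
theorem exists_labelledPath {β : Type} [Fintype β] (M : ℕ) {C : ℕ × ℕ → Prop} {h h' : ℕ}
    (hC : C (0, h)) (hr : (starGraph C).Reachable (0, h) (M, h')) (l : ℕ × ℕ → β) :
    ∃ L ∈ labelledPaths β M (0, h), L.length = M + 1 ∧ (L.map Prod.fst).Nodup ∧
      ∀ t ∈ L, C t.1 ∧ t.2 = l t.1 := by
  classical
  obtain ⟨w⟩ := hr
  have hlen : M ≤ w.bypass.length := by simpa using le_add_length_starGraph w.bypass
  refine ⟨_, map_take_support_mem_labelledPaths l M w.bypass hlen, ?_, ?_, ?_⟩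
  · simp [SimpleGraph.Walk.length_support]
    omega
  · rw [List.map_map]
    have : (Prod.fst ∘ fun t : ℕ × ℕ => (t, l t)) = id := rfl
    rw [this, List.map_id]
    exact (w.bypass_isPath.support_nodup).sublist (List.take_sublist _ _)
  · intro t ht
    obtain ⟨s, hs, rfl⟩ := List.mem_map.1 ht
    exact ⟨mem_support_starGraph _ hC s (List.mem_of_mem_take hs), rfl⟩

/-! ### Lattice paths -/

theorem lattice_adj_iff {n : ℕ} {x y : Site n} :
    (lattice n).Adj x y ↔ ∃ i, |x i - y i| = 1 ∧ ∀ i', i' ≠ i → x i' = y i' := by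
  change ∑ i, |x i - y i| = 1 ↔ _
  constructor
  · intro h
    obtain ⟨i, hi⟩ : ∃ i, |x i - y i| ≠ 0 := by
      by_contra! hc
      simp [hc] at h
    have h1 := Finset.add_sum_erase Finset.univ (fun i => |x i - y i|) (Finset.mem_univ i)
    have h2 : 0 ≤ ∑ i' ∈ Finset.univ.erase i, |x i' - y i'| :=
      Finset.sum_nonneg fun _ _ => abs_nonneg _
    have h3 := abs_nonneg (x i - y i)
    refine ⟨i, by omega, fun i' hi' => ?_⟩
    have h4 : ∑ i' ∈ Finset.univ.erase i, |x i' - y i'| = 0 := by omega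
    have h5 := (Finset.sum_eq_zero_iff_of_nonneg fun _ _ => abs_nonneg _).1 h4 i'
      (Finset.mem_erase.2 ⟨hi', Finset.mem_univ _⟩)
    exact sub_eq_zero.1 (abs_eq_zero.1 h5)
  · rintro ⟨i, hi, h⟩
    rw [Finset.sum_eq_single i _ (by simp), hi]
    intro i' _ hi'
    simp [h i' hi']

theorem hyperplaneConfig_eq_true {k n : ℕ} {ω : ∀ I : IndexSet k n, Config (CoordHyperplane I)}
    {x : Site n} : hyperplaneConfig ω x = true ↔ ∀ I, ω I (proj I x) = true := by
  simp [hyperplaneConfig]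

theorem proj_eq_proj_iff {k n : ℕ} {I : IndexSet k n} {x y : Site n} :
    proj I x = proj I y ↔ ∀ i ∈ I.1, x i = y i := by
  constructor
  · intro h i hi
    have := congrFun (congrArg Subtype.val h) i
    simpa [proj, hi] using this
  · intro h
    ext i
    by_cases hi : i ∈ I.1
    · simp [proj, hi, h i hi]
    · simp [proj, hi]

theorem Connected.of_walk {n : ℕ} {η : Config (Site n)} {x y : Site n}
    (w : (lattice n).Walk x y) (hw : ∀ z ∈ w.support, η z = true) : Connected η x y := by
  classical
  exact ⟨w.bypass, w.bypass_isPath, fun z hz => hw z (w.support_bypass_subset_support hz)⟩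

theorem Connected.concat {n : ℕ} {η : Config (Site n)} {x y z : Site n}
    (h : Connected η x y) (hyz : (lattice n).Adj y z) (hz : η z = true) : Connected η x z := by
  obtain ⟨w, -, hw⟩ := h
  refine Connected.of_walk (w.concat hyz) fun u hu => ?_
  rw [SimpleGraph.Walk.support_concat, List.mem_append] at hu
  rcases hu with hu | hu
  · exact hw u hu
  · rw [List.mem_singleton.1 hu]; exact hz

theorem Connected.open_right {n : ℕ} {η : Config (Site n)} {x y : Site n}
    (h : Connected η x y) : η y = true := by
  obtain ⟨w, -, hw⟩ := h
  exact hw y w.end_mem_support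

theorem exists_mem_support_boxBoundary {n K : ℕ} {x y : Site n} (w : (lattice n).Walk x y)
    (hx : ∀ i, |x i| ≤ (K : ℤ)) (hy : ∃ i, (K : ℤ) ≤ |y i|) :
    ∃ z ∈ w.support, z ∈ boxBoundary n K := by
  induction w with
  | nil =>
    obtain ⟨i, hi⟩ := hy
    exact ⟨_, by simp, hx, i, le_antisymm (hx i) hi⟩
  | @cons u v _ h q ih =>
    by_cases hu : ∃ i, |u i| = (K : ℤ)
    · exact ⟨u, by simp, hx, hu⟩
    · push Not at hu
      obtain ⟨i, hi, hne⟩ := lattice_adj_iff.1 h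
      obtain ⟨z, hz, hzb⟩ := ih (fun i' => by
        have h1 := hx i'
        have h2 := hu i'
        by_cases hii : i' = i
        · subst hii
          have h3 : |v i'| ≤ |u i'| + |u i' - v i'| := by
            have := abs_sub_abs_le_abs_sub (v i') (u i')
            rw [abs_sub_comm (v i')] at this
            omega
          omega
        · rw [← hne i' hii]; exact h1) hy
      exact ⟨z, by simp [hz], hzb⟩

theorem Connected.mem_connectedToBoundary {n K : ℕ} {η : Config (Site n)} {y : Site n}
    (h : Connected η 0 y) (hy : ∃ i, (K : ℤ) ≤ |y i|) : η ∈ connectedToBoundary n K := by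
  classical
  obtain ⟨w, -, hw⟩ := h
  obtain ⟨z, hz, hzb⟩ := exists_mem_support_boxBoundary w (by simp) hy
  exact ⟨z, hzb, Connected.of_walk (w.takeUntil z hz)
    fun u hu => hw u (w.support_takeUntil_subset_support hz hu)⟩

/-! ### A vertical strip over a staircase -/

/-- The site at height `h` above the `j`-th vertex of the staircase in `ℤᵈ` whose steps go
cyclically through the coordinate directions. -/
def site (d : ℕ) (j h : ℤ) : Site (d + 1) :=
  fun i => if i = Fin.last d then h else (j + (i : ℕ)) / d

theorem site_last (d : ℕ) (j h : ℤ) : site d j h (Fin.last d) = h := if_pos rfl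

theorem site_of_ne {d : ℕ} (j h : ℤ) {i : Fin (d + 1)} (hi : i ≠ Fin.last d) :
    site d j h i = (j + (i : ℕ)) / d := if_neg hi

theorem site_zero_zero (d : ℕ) : site d 0 0 = 0 := by
  ext i
  by_cases hi : i = Fin.last d
  · rw [hi, site_last]; rfl
  · rw [site_of_ne _ _ hi, zero_add]
    exact Int.ediv_eq_zero_of_lt (by omega) (by exact_mod_cast Fin.val_lt_last hi)

theorem add_one_ediv_of_dvd {a d : ℤ} (hd : 0 < d) (h : d ∣ a + 1) :
    (a + 1) / d = a / d + 1 := by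
  obtain ⟨c, hc⟩ := h
  rw [hc, Int.mul_ediv_cancel_left _ hd.ne']
  have : a = (d - 1) + d * (c - 1) := by linarith [mul_sub d c 1]
  rw [this, Int.add_mul_ediv_left _ _ hd.ne', Int.ediv_eq_zero_of_lt (by omega) (by omega)]
  ring

theorem add_one_ediv_of_not_dvd {a d : ℤ} (hd : 0 < d) (h : ¬d ∣ a + 1) :
    (a + 1) / d = a / d := by
  have h1 := Int.emod_add_mul_ediv a d
  have h2 := Int.emod_nonneg a hd.ne'
  have h3 := Int.emod_lt_of_pos a hd
  have h4 : a % d + 1 ≠ d := fun h4 => h ⟨a / d + 1, by rw [mul_add]; linarith⟩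
  have h5 : a + 1 = (a % d + 1) + d * (a / d) := by linarith
  rw [h5, Int.add_mul_ediv_left _ _ hd.ne', Int.ediv_eq_zero_of_lt (by omega) (by omega), zero_add]

/-- Among `d` consecutive integers exactly one is divisible by `d`, so exactly one of the quotients
`(j + i) / d` increases, by one, when `j` does. -/
theorem site_adj_right {d : ℕ} (hd : 0 < d) (j h : ℤ) :
    (lattice (d + 1)).Adj (site d j h) (site d (j + 1) h) := by
  have hd' : (0 : ℤ) < d := by exact_mod_cast hd
  have hm := Int.emod_nonneg (-(j + 1)) hd'.ne'
  have hm' := Int.emod_lt_of_pos (-(j + 1)) hd'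
  obtain ⟨m, hm0⟩ := Int.eq_ofNat_of_zero_le hm
  have hmd : m < d := by omega
  have hdvd : (d : ℤ) ∣ j + 1 + m := by
    rw [← hm0]
    have := Int.emod_add_mul_ediv (-(j + 1)) d
    exact ⟨-(-(j + 1) / d), by rw [mul_neg]; linarith⟩
  have e : ∀ i : ℕ, j + 1 + (i : ℤ) = j + i + 1 := fun i => by ring
  have hne : (⟨m, by omega⟩ : Fin (d + 1)) ≠ Fin.last d := fun hc => by
    have := congrArg Fin.val hc
    simp at this
    omega
  refine lattice_adj_iff.2 ⟨⟨m, by omega⟩, ?_, fun i hi => ?_⟩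
  · rw [site_of_ne _ _ hne, site_of_ne _ _ hne]
    simp only
    rw [e, add_one_ediv_of_dvd hd' (by rwa [← e])]
    simp
  · by_cases hl : i = Fin.last d
    · rw [hl, site_last, site_last]
    · rw [site_of_ne _ _ hl, site_of_ne _ _ hl, e, add_one_ediv_of_not_dvd hd']
      rw [← e]
      intro hdvd'
      have hlt : (i : ℕ) < d := Fin.val_lt_last hl
      have hne' : (i : ℕ) ≠ m := fun hc => hi (Fin.ext hc)
      have hsub : (d : ℤ) ∣ (i : ℤ) - m := by
        have := dvd_sub hdvd' hdvd
        rwa [add_sub_add_left_eq_sub] at this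
      have := Int.eq_zero_of_abs_lt_dvd hsub (abs_lt.2 ⟨by omega, by omega⟩)
      omega

theorem site_adj_up (d : ℕ) (j h : ℤ) :
    (lattice (d + 1)).Adj (site d j h) (site d j (h + 1)) := by
  refine lattice_adj_iff.2 ⟨Fin.last d, ?_, fun i hi => ?_⟩
  · rw [site_last, site_last]; simp
  · rw [site_of_ne _ _ hi, site_of_ne _ _ hi]

/-! ### The barrier around the strip -/

/-- The displacements that lead from the bottom of the strip to the places where the states of the
barrier are prescribed. -/
def shift (d K : ℕ) : Option (Fin (d + 1) × Bool) → Site (d + 1)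
  | none => 0
  | some (i, s) => Pi.single i (if s then (if i = Fin.last d then (K : ℤ) + 1 else 1) else -1)

open Classical in
/-- The places where the states of the barrier are prescribed. -/
noncomputable def barrierSet (k d M K : ℕ) :
    Finset (Σ I : IndexSet k (d + 1), CoordHyperplane I) :=
  (Finset.univ : Finset (IndexSet k (d + 1) × Fin (M + 1) × Option (Fin (d + 1) × Bool))).image
    fun t => ⟨t.1, proj t.1 (site d (t.2.1 : ℕ) 0 + shift d K t.2.2)⟩

open Classical in
/-- The states of the barrier: the projections of the bottom of the strip are open, while the
neighbours of its horizontal projections and the layers just below and above the strip are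
closed. -/
noncomputable def barrierState (k d M : ℕ) (v : Σ I : IndexSet k (d + 1), CoordHyperplane I) :
    Bool :=
  decide (v.2.1 (Fin.last d) = 0 ∧
    (Fin.last d ∉ v.1.1 → ∃ j : ℕ, j ≤ M ∧ v.2 = proj v.1 (site d j 0)))

/-- The event that the barrier is present. -/
def barrier (k d M K : ℕ) : Set (∀ I : IndexSet k (d + 1), Config (CoordHyperplane I)) :=
  {ω | ∀ v ∈ barrierSet k d M K, ω v.1 v.2 = barrierState k d M v}

theorem card_barrierSet_le (k d M K : ℕ) :
    (barrierSet k d M K).card ≤ Fintype.card (IndexSet k (d + 1)) * (2 * d + 3) * (M + 1) := by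
  classical
  refine Finset.card_image_le.trans ?_
  rw [Finset.card_univ]
  simp only [Fintype.card_prod, Fintype.card_fin, Fintype.card_option, Fintype.card_bool]
  apply le_of_eq
  ring

theorem mem_barrierSet {k d M K : ℕ} (I : IndexSet k (d + 1)) {j : ℕ} (hj : j ≤ M)
    (s : Option (Fin (d + 1) × Bool)) :
    (⟨I, proj I (site d j 0 + shift d K s)⟩ : Σ I : IndexSet k (d + 1), CoordHyperplane I) ∈
      barrierSet k d M K := by
  classical
  exact Finset.mem_image.2 ⟨(I, ⟨j, by omega⟩, s), Finset.mem_univ _, rfl⟩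

theorem proj_last {k d : ℕ} {I : IndexSet k (d + 1)} (hI : Fin.last d ∈ I.1) (x : Site (d + 1)) :
    (proj I x).1 (Fin.last d) = x (Fin.last d) := if_pos hI

theorem barrier_base {k d M K : ℕ} {ω : ∀ I : IndexSet k (d + 1), Config (CoordHyperplane I)}
    (hω : ω ∈ barrier k d M K) {j : ℕ} (hj : j ≤ M) (I : IndexSet k (d + 1)) :
    ω I (proj I (site d j 0)) = true := by
  have h := hω _ (mem_barrierSet (K := K) I hj none)
  simp only [shift, add_zero] at h
  rw [h, barrierState, decide_eq_true_iff]
  refine ⟨?_, fun _ => ⟨j, hj, rfl⟩⟩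
  simp only [proj]
  split_ifs
  · exact site_last _ _ _
  · rfl

/-- The region enclosed by the barrier. -/
def enclosure (k d M K : ℕ) : Set (Site (d + 1)) :=
  {x | 0 ≤ x (Fin.last d) ∧ x (Fin.last d) ≤ K ∧
    ∀ I : IndexSet k (d + 1), Fin.last d ∉ I.1 → ∃ j : ℕ, j ≤ M ∧ proj I x = proj I (site d j 0)}

theorem exists_indexSet {k d : ℕ} (hk : 1 ≤ k) (hkd : k ≤ d) {i : Fin (d + 1)}
    (hi : i ≠ Fin.last d) : ∃ I : IndexSet k (d + 1), i ∈ I.1 ∧ Fin.last d ∉ I.1 := by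
  obtain ⟨I, h1, h2, h3⟩ := Finset.exists_subsuperset_card_eq
    (s := {i}) (t := Finset.univ.erase (Fin.last d)) (n := k)
    (by simpa using hi) (by simpa using hk) (by simpa using hkd)
  exact ⟨⟨I, h3⟩, h1 (Finset.mem_singleton_self i), fun h => by simpa using h2 h⟩

/-- Since `k ≤ d`, each horizontal direction lies in some `I` that omits the vertical one, which
bounds that coordinate by those of the staircase. -/
theorem finite_enclosure {k d : ℕ} (hk : 1 ≤ k) (hkd : k ≤ d) (M K : ℕ) :
    (enclosure k d M K).Finite := by
  refine (Set.finite_Icc (0 : Site (d + 1)) (fun _ => (M : ℤ) + d + K)).subset fun x hx => ?_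
  obtain ⟨h0, hK, hI⟩ := hx
  have key : ∀ i, 0 ≤ x i ∧ x i ≤ (M : ℤ) + d + K := by
    intro i
    by_cases hi : i = Fin.last d
    · subst hi; omega
    · obtain ⟨I, hiI, hl⟩ := exists_indexSet hk hkd hi
      obtain ⟨j, hj, hp⟩ := hI I hl
      rw [proj_eq_proj_iff.1 hp i hiI, site_of_ne _ _ hi]
      have hd : (i : ℕ) < d := Fin.val_lt_last hi
      refine ⟨Int.ediv_nonneg (by omega) (by omega), ?_⟩
      refine (Int.ediv_le_self _ (by omega)).trans ?_
      omega
  exact ⟨fun i => (key i).1, fun i => (key i).2⟩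

/-- A step out of the enclosure would land on a site with a projection at a place that the barrier
closes. -/
theorem mem_enclosure_of_adj {k d M K : ℕ} (hk : 2 ≤ k) (hkd : k ≤ d)
    {ω : ∀ I : IndexSet k (d + 1), Config (CoordHyperplane I)}
    (hω : ω ∈ barrier k d M K) {x y : Site (d + 1)} (hx : x ∈ enclosure k d M K)
    (hxy : (lattice (d + 1)).Adj x y) (hy : hyperplaneConfig ω y = true) :
    y ∈ enclosure k d M K := by
  rw [hyperplaneConfig_eq_true] at hy
  obtain ⟨h0, hK, hI⟩ := hx
  obtain ⟨i, hi, hne⟩ := lattice_adj_iff.1 hxy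
  by_cases hl : i = Fin.last d
  · subst hl
    have hI' : ∀ I : IndexSet k (d + 1), Fin.last d ∉ I.1 →
        ∃ j : ℕ, j ≤ M ∧ proj I y = proj I (site d j 0) := by
      intro I hIl
      obtain ⟨j, hj, hp⟩ := hI I hIl
      refine ⟨j, hj, hp ▸ proj_eq_proj_iff.2 fun i hi => (hne i ?_).symm⟩
      rintro rfl
      exact hIl hi
    have hd : (⟨0, by omega⟩ : Fin (d + 1)) ≠ Fin.last d := fun hc => by
      have := congrArg Fin.val hc
      simp at this
      omega
    obtain ⟨I', hiI, hl⟩ := exists_indexSet (by omega) hkd hd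
    obtain ⟨j, hj, hp⟩ := hI' I' hl
    -- Trading a horizontal direction of `I'` for the vertical one gives a hyperplane that sees the
    -- height, while the other coordinates still agree with staircase vertex `j`; there the barrier
    -- closes heights `-1` and `K + 1`.
    set I : IndexSet k (d + 1) := ⟨insert (Fin.last d) (I'.1.erase ⟨0, by omega⟩), by
      rw [Finset.card_insert_of_notMem (fun h => hl (Finset.mem_of_mem_erase h)),
        Finset.card_erase_of_mem hiI, I'.2]
      omega⟩ with hIdef
    have hlI : Fin.last d ∈ I.1 := Finset.mem_insert_self _ _
    have key : ∀ s : Bool, y (Fin.last d) = shift d K (some (Fin.last d, s)) (Fin.last d) →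
        y (Fin.last d) = 0 := by
      intro s hs
      have hb := hω _ (mem_barrierSet (K := K) I hj (some (Fin.last d, s)))
      have hpe : proj I (site d j 0 + shift d K (some (Fin.last d, s))) = proj I y := by
        refine proj_eq_proj_iff.2 fun i hi => ?_
        rcases Finset.mem_insert.1 hi with rfl | hi
        · rw [hs, Pi.add_apply, site_last, zero_add]
        · have hiI' := Finset.mem_of_mem_erase hi
          have hil : i ≠ Fin.last d := fun h => hl (h ▸ hiI')
          rw [proj_eq_proj_iff.1 hp i hiI']
          simp [shift, hil]
      rw [hpe] at hb
      simp only at hb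
      rw [hy I] at hb
      have := (of_decide_eq_true hb.symm).1
      rwa [proj_last hlI] at this
    have k1 := key true
    have k2 := key false
    simp only [shift, Pi.single_eq_same, if_true, Bool.false_eq_true, if_false] at k1 k2
    have := abs_le.1 hi.le
    refine ⟨?_, ?_, hI'⟩
    · by_contra hc
      have := k2 (by omega)
      omega
    · by_contra hc
      have := k1 (by omega)
      omega
  · refine ⟨hne _ (Ne.symm hl) ▸ h0, hne _ (Ne.symm hl) ▸ hK, fun I hIl => ?_⟩
    obtain ⟨j, hj, hp⟩ := hI I hIl
    obtain ⟨s, hs⟩ : ∃ s : Bool, y i = x i + if s then 1 else -1 := by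
      rcases (abs_eq one_pos.le).1 hi with h | h
      · exact ⟨false, by simp; omega⟩
      · exact ⟨true, by simp; omega⟩
    have hb := hω _ (mem_barrierSet (K := K) I hj (some (i, s)))
    have hpe : proj I (site d j 0 + shift d K (some (i, s))) = proj I y := by
      refine proj_eq_proj_iff.2 fun i' hi' => ?_
      rw [Pi.add_apply, ← proj_eq_proj_iff.1 hp i' hi']
      by_cases hii : i' = i
      · subst hii
        simp [shift, hl, hs]
      · simp [shift, hii, hne i' hii]
    rw [hpe] at hb
    simp only at hb
    rw [hy I] at hb
    exact (of_decide_eq_true hb.symm).2 hIl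

theorem not_connectedToInfinity {k d M K : ℕ} (hk : 2 ≤ k) (hkd : k ≤ d)
    {ω : ∀ I : IndexSet k (d + 1), Config (CoordHyperplane I)}
    (hω : ω ∈ barrier k d M K) :
    hyperplaneConfig ω ∈ (connectedToInfinity (d + 1))ᶜ := by
  have key : ∀ {x y : Site (d + 1)} (w : (lattice (d + 1)).Walk x y),
      (∀ z ∈ w.support, hyperplaneConfig ω z = true) → x ∈ enclosure k d M K →
      y ∈ enclosure k d M K := by
    intro x y w
    induction w with
    | nil => exact fun _ h => h
    | cons h q ih =>
      intro hs hx
      refine ih (fun z hz => hs z (by simp [hz])) (mem_enclosure_of_adj hk hkd hω hx h ?_)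
      exact hs _ (by simp)
  intro hinf
  refine hinf ((finite_enclosure (by omega) hkd M K).subset ?_)
  rintro y ⟨w, -, hw⟩
  refine key w hw ⟨by simp, by simp, fun I _ => ⟨0, Nat.zero_le _, ?_⟩⟩
  rw [Nat.cast_zero, site_zero_zero]

/-! ### Crossings of the strip -/

/-- The closed points of the strip. -/
def closedPoint {d : ℕ} (M K : ℕ) (η : Config (Site (d + 1))) (t : ℕ × ℕ) : Prop :=
  t.1 ≤ M ∧ 1 ≤ t.2 ∧ t.2 ≤ K ∧ η (site d t.1 t.2) = false

/-- Duality is applied to the strip points joined to the origin by open paths anywhere in the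
lattice: an unreached neighbour of a reached point must be closed. -/
theorem exists_closed_of_not_connectedToBoundary {k d M K : ℕ} (hd : 0 < d)
    {ω : ∀ I : IndexSet k (d + 1), Config (CoordHyperplane I)}
    (hω : ω ∈ barrier k d M K)
    (h : hyperplaneConfig ω ∉ connectedToBoundary (d + 1) K) :
    ∃ h h', closedPoint M K (hyperplaneConfig ω) (0, h) ∧
      (starGraph (closedPoint M K (hyperplaneConfig ω))).Reachable (0, h) (M, h') := by
  set η := hyperplaneConfig ω with hη
  have base : ∀ j : ℕ, j ≤ M → η (site d j 0) = true := fun j hj =>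
    hyperplaneConfig_eq_true.2 fun I => barrier_base hω hj I
  have pos : ∀ j t : ℕ, j ≤ M → η (site d j t) = false → 1 ≤ t := by
    intro j t hj ht
    by_contra hc
    obtain rfl : t = 0 := by omega
    rw [Nat.cast_zero, base j hj] at ht
    exact absurd ht (by simp)
  have step : ∀ j t j' t' : ℕ, j' ≤ M → t' ≤ K →
      (lattice (d + 1)).Adj (site d j t) (site d j' t') → Connected η 0 (site d j t) →
      ¬Connected η 0 (site d j' t') → closedPoint M K η (j', t') := by
    intro j t j' t' hj' ht' hadj h1 h2
    have h3 : η (site d j' t') = false := by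
      by_contra hc
      exact h2 (h1.concat hadj (by simpa using hc))
    exact ⟨hj', pos j' t' hj' h3, ht', h3⟩
  have right : ∀ j t : ℕ, (lattice (d + 1)).Adj (site d j t) (site d (j + 1 : ℕ) t) := by
    intro j t
    push_cast
    exact site_adj_right hd _ _
  have up : ∀ j t : ℕ, (lattice (d + 1)).Adj (site d j t) (site d j (t + 1 : ℕ)) := by
    intro j t
    push_cast
    exact site_adj_up d _ _
  refine exists_star_crossing M K (fun t => Connected η 0 (site d t.1 t.2)) _ ?_ ?_ ?_ ?_ ?_
  · intro j
    induction j with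
    | zero =>
      intro _
      have h0 := base 0 (Nat.zero_le _)
      simp only [Nat.cast_zero, site_zero_zero] at h0 ⊢
      exact Connected.of_walk .nil (by simpa using h0)
    | succ j ih =>
      intro hj
      exact (ih (by omega)).concat (right j 0) (by simpa using base (j + 1) hj)
  · intro j _ hc
    refine h (hc.mem_connectedToBoundary ⟨Fin.last d, ?_⟩)
    rw [site_last]
    exact le_abs_self _
  · intro t ht hc
    have := hc.open_right
    rw [ht.2.2.2] at this
    exact absurd this (by simp)
  · intro j hj t ht
    exact ⟨step j t (j + 1) t hj ht (right j t), step (j + 1) t j t hj.le ht (right j t).symm⟩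
  · intro j hj t ht
    exact ⟨step j t j (t + 1) hj ht (up j t), step j (t + 1) j t hj ht.le (up j t).symm⟩

theorem exists_closed_projection {k d M K : ℕ}
    {ω : ∀ I : IndexSet k (d + 1), Config (CoordHyperplane I)}
    (hω : ω ∈ barrier k d M K) {t : ℕ × ℕ} (ht : closedPoint M K (hyperplaneConfig ω) t) :
    ∃ I : IndexSet k (d + 1), Fin.last d ∈ I.1 ∧ ω I (proj I (site d t.1 t.2)) = false := by
  obtain ⟨h1, -, -, h4⟩ := ht
  have h5 : ¬hyperplaneConfig ω (site d t.1 t.2) = true := by simp [h4]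
  rw [hyperplaneConfig_eq_true] at h5
  push Not at h5
  obtain ⟨I, hI⟩ := h5
  refine ⟨I, ?_, by simpa using hI⟩
  by_contra hl
  refine hI ?_
  rw [← barrier_base hω h1 I]
  congr 1
  refine proj_eq_proj_iff.2 fun i hi => ?_
  have hil : i ≠ Fin.last d := fun h => hl (h ▸ hi)
  rw [site_of_ne _ _ hil, site_of_ne _ _ hil]

/-! ### Probability estimates -/

/-- The joint law of the percolations on the coordinate hyperplanes. -/
noncomputable def productLaw {k n : ℕ} (p : IndexSet k n → unitInterval) :
    Measure (∀ I : IndexSet k n, Config (CoordHyperplane I)) :=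
  Measure.pi fun I : IndexSet k n => bernoulliSite (CoordHyperplane I) (p I)

instance {k n : ℕ} (p : IndexSet k n → unitInterval) : IsProbabilityMeasure (productLaw p) := by
  unfold productLaw
  infer_instance

theorem productLaw_real_cylinder {k n : ℕ} (p : IndexSet k n → unitInterval)
    (F : Finset (Σ I : IndexSet k n, CoordHyperplane I))
    (b : (Σ I : IndexSet k n, CoordHyperplane I) → Bool) :
    (productLaw p).real {ω | ∀ v ∈ F, ω v.1 v.2 = b v} =
      ∏ v ∈ F, if b v = true then (p v.1 : ℝ) else 1 - p v.1 := by
  classical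
  let G : ∀ I : IndexSet k n, Finset (CoordHyperplane I) := fun I =>
    F.preimage (Sigma.mk I) sigma_mk_injective.injOn
  have hF : F = Finset.univ.sigma G := by
    ext ⟨I, y⟩
    simp [G]
  have hset : {ω : ∀ I : IndexSet k n, Config (CoordHyperplane I) | ∀ v ∈ F, ω v.1 v.2 = b v} =
      Set.pi Set.univ fun I => Set.pi (G I) fun y => {b ⟨I, y⟩} := by
    ext ω
    simp only [Set.mem_pi, Set.mem_univ, forall_const, Set.mem_singleton_iff, G,
      Finset.coe_preimage, Set.mem_preimage, Finset.mem_coe]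
    exact ⟨fun h I y hy => h ⟨I, y⟩ hy, fun h v hv => h v.1 v.2 hv⟩
  rw [hset, measureReal_def, productLaw, Measure.pi_pi, ENNReal.toReal_prod, hF,
    Finset.prod_sigma]
  refine Finset.prod_congr rfl fun I _ => ?_
  rw [bernoulliSite, Measure.infinitePi_pi _ (fun _ _ => measurableSet_singleton _),
    ENNReal.toReal_prod]
  refine Finset.prod_congr rfl fun y _ => ?_
  rw [← measureReal_def]
  cases b ⟨I, y⟩
  · rw [bernoulliMeasure_real_apply_of_notMem_of_mem _ (measurableSet_singleton _) (by simp)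
      (by simp)]
    simp
  · rw [bernoulliMeasure_real_apply_of_mem_of_notMem _ (measurableSet_singleton _) (by simp)
      (by simp)]
    simp

theorem pow_le_productLaw_barrier {k d M K : ℕ} {p : IndexSet k (d + 1) → unitInterval} {q : ℝ}
    (hq : 0 ≤ q) (hq1 : q ≤ 1) (hp : ∀ I, q ≤ p I ∧ q ≤ 1 - p I) :
    q ^ (Fintype.card (IndexSet k (d + 1)) * (2 * d + 3) * (M + 1)) ≤
      (productLaw p).real (barrier k d M K) := by
  rw [barrier, productLaw_real_cylinder]
  refine (pow_le_pow_of_le_one hq hq1 (card_barrierSet_le k d M K)).trans ?_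
  rw [← Finset.prod_const]
  refine Finset.prod_le_prod (fun _ _ => hq) fun v _ => ?_
  split_ifs
  exacts [(hp v.1).1, (hp v.1).2]

/-- The labelled sequences of distinct points of the strip, each label containing the vertical
direction. -/
def IsAdmissible {k d : ℕ} (M K : ℕ) (L : List ((ℕ × ℕ) × IndexSet k (d + 1))) : Prop :=
  L.length = M + 1 ∧ (L.map Prod.fst).Nodup ∧
    ∀ t ∈ L, 1 ≤ t.1.2 ∧ t.1.2 ≤ K ∧ Fin.last d ∈ t.2.1

/-- The place on the hyperplane given by the label of a labelled point to which the point
projects. -/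
def labelProj {k d : ℕ} (t : (ℕ × ℕ) × IndexSet k (d + 1)) :
    Σ I : IndexSet k (d + 1), CoordHyperplane I :=
  ⟨t.2, proj t.2 (site d t.1.1 t.1.2)⟩

theorem eq_of_labelProj_eq {k d : ℕ} {t t' : (ℕ × ℕ) × IndexSet k (d + 1)}
    (h : labelProj t = labelProj t') :
    t.2 = t'.2 ∧ ∀ i ∈ t.2.1, site d t.1.1 t.1.2 i = site d t'.1.1 t'.1.2 i := by
  have h1 : t.2 = t'.2 := congrArg Sigma.fst h
  refine ⟨h1, fun i hi => ?_⟩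
  have h2 := congrFun (congrArg (fun v : Σ I : IndexSet k (d + 1), CoordHyperplane I => v.2.1) h) i
  simpa [labelProj, proj, hi, h1 ▸ hi] using h2

/-- On hyperplanes containing the vertical direction the barrier occupies only heights `-1`, `0` and
`K + 1`. -/
theorem labelProj_notMem_barrierSet {k d M K : ℕ} {t : (ℕ × ℕ) × IndexSet k (d + 1)}
    (h1 : 1 ≤ t.1.2) (hK : t.1.2 ≤ K) (hl : Fin.last d ∈ t.2.1) :
    labelProj t ∉ barrierSet k d M K := by
  classical
  intro h
  obtain ⟨⟨I, j, s⟩, -, hs⟩ := Finset.mem_image.1 h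
  obtain rfl : I = t.2 := congrArg Sigma.fst hs
  have h2 := congrFun (congrArg (fun v : Σ I : IndexSet k (d + 1), CoordHyperplane I => v.2.1) hs)
    (Fin.last d)
  simp only [labelProj, proj, hl, if_true, Pi.add_apply, site_last, zero_add] at h2
  rcases s with _ | ⟨i, s⟩
  · simp only [shift, Pi.zero_apply] at h2
    omega
  · by_cases hi : i = Fin.last d
    · subst hi
      cases s
      · simp [shift] at h2
      · simp [shift] at h2
        omega
    · simp only [shift, Pi.single_eq_of_ne (Ne.symm hi)] at h2
      omega

open Classical in
-- A projected place fixes the label, the height and one quotient `(j + i) / d`, which leaves only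
-- `d` consecutive values of `j`.
theorem length_le_mul_card_image_labelProj {k d M K : ℕ} (hd : 0 < d) (hk : 2 ≤ k)
    {L : List ((ℕ × ℕ) × IndexSet k (d + 1))} (hL : IsAdmissible M K L) :
    M + 1 ≤ d * (L.toFinset.image labelProj).card := by
  obtain ⟨hlen, hnd, hL⟩ := hL
  rw [← hlen, ← List.toFinset_card_of_nodup hnd.of_map]
  refine Finset.card_le_mul_card_image _ _ fun v hv => ?_
  obtain ⟨t₀, ht₀, rfl⟩ := Finset.mem_image.1 hv
  have hl := (hL t₀ (List.mem_toFinset.1 ht₀)).2.2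
  obtain ⟨i, hi⟩ : (t₀.2.1.erase (Fin.last d)).Nonempty := by
    rw [← Finset.card_pos, Finset.card_erase_of_mem hl, t₀.2.2]
    omega
  obtain ⟨hil, hi⟩ := Finset.mem_erase.1 hi
  have hd' : (0 : ℤ) < d := by exact_mod_cast hd
  set c := site d t₀.1.1 t₀.1.2 i
  have hcard : (Finset.Ico (d * c - (i : ℕ) : ℤ) (d * c - (i : ℕ) + d)).card = d := by simp
  refine (Finset.card_le_card_of_injOn (fun t => (t.1.1 : ℤ)) ?_ ?_).trans hcard.le
  · intro t ht
    obtain ⟨-, ht⟩ := Finset.mem_filter.1 ht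
    obtain ⟨h1, h2⟩ := eq_of_labelProj_eq ht
    have h3 : (t.1.1 + (i : ℕ) : ℤ) / d = c :=
      (site_of_ne _ (t.1.2 : ℤ) hil).symm.trans (h2 i (h1 ▸ hi))
    have h4 := Int.emod_add_mul_ediv (t.1.1 + (i : ℕ) : ℤ) d
    have h5 := Int.emod_nonneg (t.1.1 + (i : ℕ) : ℤ) hd'.ne'
    have h6 := Int.emod_lt_of_pos (t.1.1 + (i : ℕ) : ℤ) hd'
    rw [h3] at h4
    simp only [Finset.coe_Ico, Set.mem_Ico]
    omega
  · intro t ht t' ht' htt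
    obtain ⟨-, ht⟩ := Finset.mem_filter.1 ht
    obtain ⟨-, ht'⟩ := Finset.mem_filter.1 ht'
    obtain ⟨h1, h2⟩ := eq_of_labelProj_eq ht
    obtain ⟨h1', h2'⟩ := eq_of_labelProj_eq ht'
    have e := h2 _ (h1 ▸ hl)
    have e' := h2' _ (h1' ▸ hl)
    rw [site_last, site_last] at e e'
    refine Prod.ext (Prod.ext (by simpa using htt) ?_) (h1.trans h1'.symm)
    omega

theorem productLaw_closed_le {k d M K r : ℕ} (hd : 0 < d) (hk : 2 ≤ k) (hr : M + 1 = d * r)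
    {p : IndexSet k (d + 1) → unitInterval} {ε : ℝ} (hε0 : 0 ≤ ε) (hε1 : ε ≤ 1)
    (hp : ∀ I, 1 - ε ≤ p I) {L : List ((ℕ × ℕ) × IndexSet k (d + 1))} (hL : IsAdmissible M K L) :
    (productLaw p).real {ω | ω ∈ barrier k d M K ∧
      ∀ t ∈ L, ω t.2 (proj t.2 (site d t.1.1 t.1.2)) = false} ≤
      (productLaw p).real (barrier k d M K) * ε ^ r := by
  classical
  set F := barrierSet k d M K with hF
  set G := L.toFinset.image labelProj with hG
  have hdisj : ∀ v ∈ G, v ∉ F := by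
    intro v hv
    obtain ⟨t, ht, rfl⟩ := Finset.mem_image.1 hv
    obtain ⟨h1, h2, h3⟩ := hL.2.2 t (List.mem_toFinset.1 ht)
    exact labelProj_notMem_barrierSet h1 h2 h3
  -- Disjointness of `F` and `G` turns the joint event into a single cylinder, so its probability
  -- factorises.
  have hset : {ω : ∀ I : IndexSet k (d + 1), Config (CoordHyperplane I) | ω ∈ barrier k d M K ∧
      ∀ t ∈ L, ω t.2 (proj t.2 (site d t.1.1 t.1.2)) = false} =
      {ω | ∀ v ∈ F ∪ G, ω v.1 v.2 = if v ∈ F then barrierState k d M v else false} := by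
    ext ω
    constructor
    · rintro ⟨h1, h2⟩ v hv
      by_cases hvF : v ∈ F
      · rw [if_pos hvF]; exact h1 v hvF
      · rw [if_neg hvF]
        obtain ⟨t, ht, rfl⟩ := Finset.mem_image.1 ((Finset.mem_union.1 hv).resolve_left hvF)
        exact h2 t (List.mem_toFinset.1 ht)
    · intro h
      refine ⟨fun v hv => ?_, fun t ht => ?_⟩
      · have := h v (Finset.mem_union_left _ hv)
        rwa [if_pos hv] at this
      · have hv : labelProj t ∈ G := Finset.mem_image_of_mem _ (List.mem_toFinset.2 ht)
        have := h _ (Finset.mem_union_right _ hv)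
        rwa [if_neg (hdisj _ hv)] at this
  have hcard : r ≤ G.card := by
    have := length_le_mul_card_image_labelProj hd hk hL
    rw [hr] at this
    exact Nat.le_of_mul_le_mul_left this hd
  have hnn : ∀ v : Σ I : IndexSet k (d + 1), CoordHyperplane I,
      0 ≤ if barrierState k d M v = true then (p v.1 : ℝ) else 1 - p v.1 := by
    intro v
    have h1 := (p v.1).2.1
    have h2 := (p v.1).2.2
    split_ifs <;> linarith
  rw [hset, productLaw_real_cylinder, barrier, productLaw_real_cylinder,
    Finset.prod_union (Finset.disjoint_right.2 hdisj)]
  have e1 : (∏ v ∈ F, if (if v ∈ F then barrierState k d M v else false) = true then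
      (p v.1 : ℝ) else 1 - p v.1) =
      ∏ v ∈ F, if barrierState k d M v = true then (p v.1 : ℝ) else 1 - p v.1 :=
    Finset.prod_congr rfl fun v hv => by rw [if_pos hv]
  have e2 : (∏ v ∈ G, if (if v ∈ F then barrierState k d M v else false) = true then
      (p v.1 : ℝ) else 1 - p v.1) = ∏ v ∈ G, (1 - (p v.1 : ℝ)) :=
    Finset.prod_congr rfl fun v hv => by simp [hdisj v hv]
  rw [e1, e2]
  refine mul_le_mul_of_nonneg_left ?_ (Finset.prod_nonneg fun v _ => hnn v)
  refine le_trans ?_ (pow_le_pow_of_le_one hε0 hε1 hcard)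
  rw [← Finset.prod_const]
  refine Finset.prod_le_prod (fun v _ => ?_) fun v _ => ?_
  · linarith [(p v.1).2.2]
  · linarith [hp v.1]

theorem productLaw_not_crossing_le {k d M K r : ℕ} (hd : 0 < d) (hk : 2 ≤ k)
    (hr : M + 1 = d * r) {p : IndexSet k (d + 1) → unitInterval} {ε : ℝ} (hε0 : 0 ≤ ε)
    (hε1 : ε ≤ 1) (hp : ∀ I, 1 - ε ≤ p I) :
    (productLaw p).real {ω | ω ∈ barrier k d M K ∧
      hyperplaneConfig ω ∉ connectedToBoundary (d + 1) K} ≤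
      (K + 1) * (9 * Fintype.card (IndexSet k (d + 1))) ^ (M + 1) *
        ((productLaw p).real (barrier k d M K) * ε ^ r) := by
  classical
  set B := (productLaw p).real (barrier k d M K) with hB
  set N := Fintype.card (IndexSet k (d + 1)) with hN
  let P : ℕ → Finset (List ((ℕ × ℕ) × IndexSet k (d + 1))) := fun h =>
    (labelledPaths (IndexSet k (d + 1)) M (0, h)).filter (IsAdmissible M K)
  let A : List ((ℕ × ℕ) × IndexSet k (d + 1)) →
      Set (∀ I : IndexSet k (d + 1), Config (CoordHyperplane I)) := fun L =>
    {ω | ω ∈ barrier k d M K ∧ ∀ t ∈ L, ω t.2 (proj t.2 (site d t.1.1 t.1.2)) = false}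
  have hsub : {ω | ω ∈ barrier k d M K ∧
      hyperplaneConfig ω ∉ connectedToBoundary (d + 1) K} ⊆
      ⋃ h ∈ Finset.range (K + 1), ⋃ L ∈ P h, A L := by
    rintro ω ⟨hω, hn⟩
    obtain ⟨h, h', hc, hr⟩ := exists_closed_of_not_connectedToBoundary hd hω hn
    have hl : ∀ t : ℕ × ℕ, ∃ I : IndexSet k (d + 1), closedPoint M K (hyperplaneConfig ω) t →
        Fin.last d ∈ I.1 ∧ ω I (proj I (site d t.1 t.2)) = false := by
      intro t
      by_cases ht : closedPoint M K (hyperplaneConfig ω) t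
      · obtain ⟨I, hI⟩ := exists_closed_projection hω ht
        exact ⟨I, fun _ => hI⟩
      · obtain ⟨I, -⟩ := exists_closed_projection hω hc
        exact ⟨I, fun h => absurd h ht⟩
    -- Labels of points that are not closed are arbitrary; the path never visits them.
    choose l hl using hl
    obtain ⟨L, hL, hlen, hnd, hLc⟩ := exists_labelledPath M hc hr l
    simp only [Set.mem_iUnion]
    refine ⟨h, Finset.mem_range.2 (by have := hc.2.2.1; omega), L,
      Finset.mem_filter.2 ⟨hL, hlen, hnd, fun t ht => ?_⟩, hω, fun t ht => ?_⟩
    · obtain ⟨h1, h2⟩ := hLc t ht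
      exact ⟨h1.2.1, h1.2.2.1, h2 ▸ (hl _ h1).1⟩
    · obtain ⟨h1, h2⟩ := hLc t ht
      rw [h2]
      exact (hl _ h1).2
  have hBε : 0 ≤ B * ε ^ r := mul_nonneg measureReal_nonneg (pow_nonneg hε0 r)
  have hrow : ∀ h, (productLaw p).real (⋃ L ∈ P h, A L) ≤ (9 * N : ℝ) ^ (M + 1) * (B * ε ^ r) := by
    intro h
    refine (measureReal_biUnion_finset_le _ _).trans ?_
    refine (Finset.sum_le_card_nsmul _ _ (B * ε ^ r) fun L hL =>
      productLaw_closed_le hd hk hr hε0 hε1 hp (Finset.mem_filter.1 hL).2).trans ?_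
    rw [nsmul_eq_mul]
    refine mul_le_mul_of_nonneg_right ?_ hBε
    exact_mod_cast (Finset.card_filter_le _ _).trans (card_labelledPaths_le _ M (0, h))
  calc _ ≤ (productLaw p).real (⋃ h ∈ Finset.range (K + 1), ⋃ L ∈ P h, A L) :=
        measureReal_mono hsub (measure_ne_top _ _)
    _ ≤ ∑ h ∈ Finset.range (K + 1), (productLaw p).real (⋃ L ∈ P h, A L) :=
        measureReal_biUnion_finset_le _ _
    _ ≤ (Finset.range (K + 1)).card • ((9 * N : ℝ) ^ (M + 1) * (B * ε ^ r)) :=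
        Finset.sum_le_card_nsmul _ _ _ fun h _ => hrow h
    _ = _ := by
        rw [nsmul_eq_mul, Finset.card_range]
        push_cast
        ring

theorem half_productLaw_barrier_le {k d M K r : ℕ} (hk : 2 ≤ k) (hkd : k ≤ d)
    (hr : M + 1 = d * r) (hK : 2 * (K + 1) ≤ 2 ^ r)
    {p : IndexSet k (d + 1) → unitInterval}
    (hp : ∀ I, 1 - (1 / (18 * Fintype.card (IndexSet k (d + 1))) : ℝ) ^ d ≤ p I) :
    (productLaw p).real (barrier k d M K) / 2 ≤
      (percolationLaw p).real (connectedToBoundary (d + 1) K ∩ (connectedToInfinity (d + 1))ᶜ) := by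
  have hd : 0 < d := by omega
  have hI : Nonempty (IndexSet k (d + 1)) := by
    obtain ⟨I, -⟩ := exists_indexSet (k := k) (by omega) hkd (i := (⟨0, by omega⟩ : Fin (d + 1)))
      (fun hc => by
        have := congrArg Fin.val hc
        simp at this
        omega)
    exact ⟨I⟩
  have hN : (1 : ℝ) ≤ Fintype.card (IndexSet k (d + 1)) := by
    exact_mod_cast Fintype.card_pos
  set N : ℝ := (Fintype.card (IndexSet k (d + 1)) : ℝ) with hNdef
  set B := (productLaw p).real (barrier k d M K) with hB
  have hB0 : 0 ≤ B := measureReal_nonneg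
  have hx0 : 0 ≤ 1 / (18 * N) := by positivity
  have hx1 : 1 / (18 * N) ≤ 1 := by
    rw [div_le_one (by positivity)]
    linarith
  have h1 := productLaw_not_crossing_le (K := K) hd hk hr (pow_nonneg hx0 d)
    (pow_le_one₀ hx0 hx1) hp
  rw [← hB, ← hNdef] at h1
  have h2 : (K + 1 : ℝ) * (9 * N) ^ (M + 1) * (B * ((1 / (18 * N)) ^ d) ^ r) ≤ B / 2 := by
    -- Since `M + 1 = d * r`, the `d`-th power in `ε` cancels the path count and leaves a factor
    -- `1/2` per point.
    have e : (9 * N) ^ (M + 1) * ((1 / (18 * N)) ^ d) ^ r = (1 / 2) ^ (d * r) := by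
      rw [← pow_mul, hr, ← mul_pow]
      congr 1
      field_simp
      norm_num
    have h3 : (1 / 2 : ℝ) ^ (d * r) ≤ (1 / 2) ^ r :=
      pow_le_pow_of_le_one (by norm_num) (by norm_num) (Nat.le_mul_of_pos_left r hd)
    have h4 : (K + 1 : ℝ) * (1 / 2) ^ r ≤ 1 / 2 := by
      have : (2 * (K + 1) : ℝ) ≤ 2 ^ r := by exact_mod_cast hK
      rw [one_div, inv_pow, ← div_eq_mul_inv, div_le_iff₀ (by positivity)]
      linarith
    calc _ = (K + 1 : ℝ) * ((9 * N) ^ (M + 1) * ((1 / (18 * N)) ^ d) ^ r) * B := by ring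
      _ ≤ 1 / 2 * B := by
          refine mul_le_mul_of_nonneg_right ?_ hB0
          rw [e]
          exact (mul_le_mul_of_nonneg_left h3 (by positivity)).trans h4
      _ = B / 2 := by ring
  have h3 : barrier k d M K ⊆ {ω | ω ∈ barrier k d M K ∧
      hyperplaneConfig ω ∉ connectedToBoundary (d + 1) K} ∪
      hyperplaneConfig ⁻¹' (connectedToBoundary (d + 1) K ∩ (connectedToInfinity (d + 1))ᶜ) := by
    intro ω hω
    by_cases hc : hyperplaneConfig ω ∈ connectedToBoundary (d + 1) K
    · exact Or.inr ⟨hc, not_connectedToInfinity hk hkd hω⟩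
    · exact Or.inl ⟨hω, hc⟩
  have h4 : B ≤ _ := (measureReal_mono h3).trans (measureReal_union_le _ _)
  have h5 : (productLaw p).real (hyperplaneConfig ⁻¹' (connectedToBoundary (d + 1) K ∩
      (connectedToInfinity (d + 1))ᶜ)) ≤
      (percolationLaw p).real (connectedToBoundary (d + 1) K ∩ (connectedToInfinity (d + 1))ᶜ) :=
    -- Only this inequality is needed, and it holds without measurability of the event.
    ENNReal.toReal_mono (measure_ne_top _ _)
      (Measure.le_map_apply measurable_hyperplaneConfig.aemeasurable _)
  linarith

end HyperplanePercolation

theorem mainTheorem3 (n k : ℕ) (hn : 3 ≤ n) (hk : 2 ≤ k) (hkn : k ≤ n - 1) :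
    ∃ ε : ℝ, 0 < ε ∧
      ∀ p : HyperplanePercolation.IndexSet k n → unitInterval,
        (∀ I, 1 - ε < (p I : ℝ) ∧ (p I : ℝ) < 1) →
        ∃ c α : ℝ, 0 < c ∧ 0 < α ∧
          ∀ K : ℕ, 0 < K →
            c * (K : ℝ) ^ (-α) ≤
              (HyperplanePercolation.percolationLaw p).real
                (HyperplanePercolation.connectedToBoundary n K ∩
                  (HyperplanePercolation.connectedToInfinity n)ᶜ) := by
  obtain ⟨d, rfl⟩ : ∃ d, n = d + 1 := ⟨n - 1, by omega⟩
  have hkd : k ≤ d := hkn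
  have hI : Nonempty (HyperplanePercolation.IndexSet k (d + 1)) := by
    obtain ⟨I, -, hI⟩ := Finset.exists_subset_card_eq
      (s := (Finset.univ : Finset (Fin (d + 1)))) (n := k) (by simp; omega)
    exact ⟨⟨I, hI⟩⟩
  set N := Fintype.card (HyperplanePercolation.IndexSet k (d + 1)) with hN
  have hN0 : 0 < N := Fintype.card_pos
  have hN1 : (1 : ℝ) ≤ N := by exact_mod_cast hN0
  have hε1 : (1 / (18 * N) : ℝ) ^ d ≤ 1 :=
    pow_le_one₀ (by positivity) (by rw [div_le_one (by positivity)]; linarith)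
  refine ⟨(1 / (18 * N) : ℝ) ^ d, by positivity, fun p hp => ?_⟩
  obtain ⟨q, hq0, hq1, hq⟩ : ∃ q : ℝ, 0 < q ∧ q < 1 ∧ ∀ I, q ≤ p I ∧ q ≤ 1 - p I := by
    obtain ⟨I₀, hI₀⟩ := Finite.exists_min fun I => min (p I : ℝ) (1 - p I)
    refine ⟨min (p I₀ : ℝ) (1 - p I₀), ?_, ?_, fun I => le_min_iff.1 (hI₀ I)⟩
    · refine lt_min ?_ ?_ <;> linarith [(hp I₀).1, (hp I₀).2]
    · exact (min_le_left _ _).trans_lt (hp I₀).2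
  -- `Q` is the cost of the barrier per unit of `r`, as `M + 1 = d * r`; with `α = -log₂ Q` one gets
  -- `Q ^ r = (2 ^ r) ^ (-α)`.
  set Q : ℝ := q ^ (N * (2 * d + 3) * d) with hQ
  have hQ0 : 0 < Q := pow_pos hq0 _
  have hQ1 : Q < 1 := pow_lt_one₀ hq0.le hq1
    (Nat.mul_pos (Nat.mul_pos hN0 (by omega)) (by omega)).ne'
  set α : ℝ := -Real.logb 2 Q with hα
  have hα0 : 0 < α := neg_pos.2 (Real.logb_neg (by norm_num) hQ0 hQ1)
  refine ⟨(4 : ℝ) ^ (-α) / 2, α, by positivity, hα0, fun K hK => ?_⟩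
  have hK' : (0 : ℝ) < K := by exact_mod_cast hK
  -- This choice gives `2 * (K + 1) ≤ 2 ^ r ≤ 4 * K`: the first bound feeds the union bound, the
  -- second produces the constant `4 ^ (-α)`.
  set r := Nat.log 2 K + 2 with hr
  have hr1 : 2 * (K + 1) ≤ 2 ^ r := by
    have := Nat.lt_pow_succ_log_self (b := 2) (by norm_num) K
    rw [hr, show Nat.log 2 K + 2 = (Nat.log 2 K).succ + 1 from rfl, pow_succ]
    omega
  have hr2 : (2 : ℝ) ^ r ≤ 4 * K := by
    have := Nat.pow_log_le_self 2 hK.ne'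
    have h : 2 ^ r ≤ 4 * K := by
      rw [hr, pow_add]
      omega
    exact_mod_cast h
  have hM : d * r - 1 + 1 = d * r := Nat.sub_add_cancel (Nat.mul_pos (by omega) (by omega))
  refine le_trans ?_ (HyperplanePercolation.half_productLaw_barrier_le hk hkd hM hr1
    fun I => (hp I).1.le)
  have h1 := HyperplanePercolation.pow_le_productLaw_barrier (M := d * r - 1) (K := K)
    hq0.le hq1.le hq
  rw [hM, ← mul_assoc, ← hN, pow_mul, ← hQ] at h1
  have h2 : Q ^ r = ((2 : ℝ) ^ r) ^ (-α) := by
    rw [hα, neg_neg, ← Real.rpow_natCast 2 r, ← Real.rpow_mul (by norm_num), mul_comm,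
      Real.rpow_mul (by norm_num), Real.rpow_logb (by norm_num) (by norm_num) hQ0,
      Real.rpow_natCast]
  have h3 : (4 * K : ℝ) ^ (-α) ≤ ((2 : ℝ) ^ r) ^ (-α) :=
    Real.rpow_le_rpow_of_nonpos (by positivity) hr2 (by linarith)
  rw [Real.mul_rpow (by norm_num) hK'.le] at h3
  linarith
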